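/- Let $p$ be a prime, $m\ge 1$, $\mathbb F=\mathbb F_{p^m}$, and let $\theta$ be a field automorphism of $\mathbb F$ of order $k>2$; write $a^\theta=\theta(a)$. Consider the following groups: - $A_p(m,\theta)=\mathbb F^2$ with $(a,b)(c,d)=(a+c,\;b+d+ac^\theta)$; - $B_p(m,\theta,0)=\mathbb F^3$ with $(a,b,c)(d,e,f)=(a+d,\;b+e,\;c+f+ad^\theta+be^\theta)$; - $C_p(m,\theta,0)=\mathbb F^3$ with $(a,b,c)(d,e,f)=(a+d,\;b+e,\;c+f+ad^\theta+be)$; - $D_p(m,\theta,0)=\mathbb F^3$ with $(a,b,c)(d,e,f)=(a+d,\;b+e,\;c+f+ad^\theta+be^{\theta^2})$. For $v\in\mathbb F$ let $\psi_v(x)=\xi_p^{\mathrm{Tr}(vx)}$ $(x\in\mathbb F)$, where $\xi_p=e^{2\pi i/p}$ and $\mathrm{Tr}$ is the absolute trace $\mathbb F\to\mathbb F_p$. Write $\mathrm{Irr}_1(G)$ for the set of complex irreducible characters of $G$ of degree different from $1$. The lift to $G$ of a character of $G/N$ is its composition with $G\to G/N$. 1. Let $G$ be $A_p(m,\theta)$,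 $B_p(m,\theta,0)$ or $D_p(m,\theta,0)$. For $v\in\mathbb F^*$ let $G_v=G/H_v$, where $H_v=\{(0,b): b\in\ker\psi_v\}$ for $A_p(m,\theta)$ and $H_v=\{(0,0,c): c\in\ker\psi_v\}$ in the other two cases. Let $T$ be any set of coset representatives for $\mathbb F_p^*$ in $\mathbb F^*$. Then for every $\chi\in\mathrm{Irr}_1(G)$ there is exactly one pair $(v,\varphi)$ with $v\in T$ and $\varphi\in\mathrm{Irr}_1(G_v)$ such that $\chi$ is the lift of $\varphi$. 2. Let $G=C_p(m,\theta,0)$; its centre is $Z(G)=\{(0,b,c): b,c\in\mathbb F\}$. For a linear character $\alpha$ of $Z(G)$ put $G_\alpha=G/\ker\alpha$. Define a set $I$ of linear characters of $Z(G)$ as follows. - If $p$ is odd, $I$ consists of the characters $\alpha^{(v,w)}(0,b,c)=\psi_w(b)\,\psi_v(c-\tfrac12 b^2)$, where $(v,w)$ runs through a set of representatives, one for each point $[v,w]$ with $v\ne0$ of the projective space of the $\mathbb F_p$-vector space $\mathbb F^2$ (any choice of representatives). - If $p=2$, fix $b_0\in\mathbb F$ with $\mathrm{Tr}(b_0)=1$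 and, if $m$ is even, $c_0\in\mathbb F$ with $c_0+c_0^{2^{m/2}}=1$. Let $Q:\mathbb F\to\mathbb F_2$ be $Q(x)=\sum_{i=0}^{(m-1)/2}\mathrm{Tr}(x^{2^i+1})$ if $m$ is odd, and $Q(x)=\sum_{i=0}^{m/2-1}\mathrm{Tr}(x^{2^i+1})+\mathrm{Tr}(c_0x^{2^{m/2}+1})$ if $m$ is even. Then $I$ consists of the characters $$\alpha^{(v,w,1)}(0,b,c)=i^{\kappa(t)}(-1)^{Q(b_1)+\mathrm{Tr}(tb_0b_1)}\,\psi_w(b_1)\,\psi_v(c),\qquad v\in\mathbb F^*,\ w\in\mathbb F/\mathbb F_2,$$ where $v^{2^{m-1}}b=tb_0+b_1$ with $t\in\mathbb F_2$ and $\mathrm{Tr}(b_1)=0$, $i=\sqrt{-1}$, and $\kappa:\mathbb F_2\to\{0,1\}\subset\mathbb Z$ is the obvious bijection. Then for every $\chi\in\mathrm{Irr}_1(G)$ there is exactly one pair $(\alpha,\varphi)$ with $\alpha\in I$ and $\varphi\in\mathrm{Irr}_1(G_\alpha)$ such that $\chi$ is the lift of $\varphi$. -/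

import Mathlib

namespace SuzukiP

/-! ### Complex irreducible characters of a group -/

section Characters

variable {G : Type*} [Group G]

/-- `χ` is the character of an irreducible complex matrix representation of `G` of finite degree. -/
def IsIrrChar (χ : G → ℂ) : Prop :=
  ∃ (d : ℕ) (ρ : Representation ℂ G (Fin d → ℂ)), ρ.IsIrreducible ∧ ρ.character = χ

variable (G) in
/-- The set of non-linear irreducible characters of `G`: those of degree `χ(1) ≠ 1`. -/
def Irr1 : Set (G → ℂ) := {χ | IsIrrChar χ ∧ χ 1 ≠ 1}

/-- The lift to `G` of a function on the quotient group `G ⧸ N`. -/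
def lift (N : Subgroup G) [N.Normal] (φ : G ⧸ N → ℂ) : G → ℂ := fun g => φ (g : G ⧸ N)

/-- The kernel of a linear character of the centre of `G`, viewed as a subgroup of `G`. -/
def centerKer (α : Subgroup.center G →* ℂˣ) : Subgroup G :=
  α.ker.map (Subgroup.center G).subtype

instance (α : Subgroup.center G →* ℂˣ) : (centerKer α).Normal := by
  constructor
  rintro _ ⟨z, hz, rfl⟩ g
  refine ⟨z, hz, ?_⟩
  have h := Subgroup.mem_center_iff.mp z.2 g
  simp [h]

end Characters

/-! ### The four families of Suzuki `p`-groups -/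

section Groups

variable {F : Type*} [Field F]

/-- The group `A_p(m,θ)`, with underlying set `F × F`. -/
@[ext]
structure A (θ : RingAut F) where
  a : F
  b : F

namespace A

variable {θ : RingAut F}

instance : Mul (A θ) := ⟨fun x y => ⟨x.a + y.a, x.b + y.b + x.a * θ y.a⟩⟩
instance : One (A θ) := ⟨⟨0, 0⟩⟩
instance : Inv (A θ) := ⟨fun x => ⟨-x.a, -x.b + x.a * θ x.a⟩⟩

@[simp] lemma mul_a (x y : A θ) : (x * y).a = x.a + y.a := rfl
@[simp] lemma mul_b (x y : A θ) : (x * y).b = x.b + y.b + x.a * θ y.a := rfl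
@[simp] lemma one_a : (1 : A θ).a = 0 := rfl
@[simp] lemma one_b : (1 : A θ).b = 0 := rfl
@[simp] lemma inv_a (x : A θ) : (x⁻¹).a = -x.a := rfl
@[simp] lemma inv_b (x : A θ) : (x⁻¹).b = -x.b + x.a * θ x.a := rfl

instance : Group (A θ) :=
  Group.ofLeftAxioms
    (by intro x y z; ext <;> simp <;> ring)
    (by intro x; ext <;> simp)
    (by intro x; ext <;> simp)

end A

/-- The group `B_p(m,θ,ε)`, with underlying set `F × F × F`. -/
@[ext]
structure B (θ : RingAut F) (ε : F) where
  a : F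
  b : F
  c : F

namespace B

variable {θ : RingAut F} {ε : F}

instance : Mul (B θ ε) :=
  ⟨fun x y => ⟨x.a + y.a, x.b + y.b,
    x.c + y.c + x.a * θ y.a + x.b * θ y.b + ε * x.a * θ y.b⟩⟩
instance : One (B θ ε) := ⟨⟨0, 0, 0⟩⟩
instance : Inv (B θ ε) :=
  ⟨fun x => ⟨-x.a, -x.b, -x.c + x.a * θ x.a + x.b * θ x.b + ε * x.a * θ x.b⟩⟩

@[simp] lemma mul_a (x y : B θ ε) : (x * y).a = x.a + y.a := rfl
@[simp] lemma mul_b (x y : B θ ε) : (x * y).b = x.b + y.b := rfl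
@[simp] lemma mul_c (x y : B θ ε) : (x * y).c =
    x.c + y.c + x.a * θ y.a + x.b * θ y.b + ε * x.a * θ y.b := rfl
@[simp] lemma one_a : (1 : B θ ε).a = 0 := rfl
@[simp] lemma one_b : (1 : B θ ε).b = 0 := rfl
@[simp] lemma one_c : (1 : B θ ε).c = 0 := rfl
@[simp] lemma inv_a (x : B θ ε) : (x⁻¹).a = -x.a := rfl
@[simp] lemma inv_b (x : B θ ε) : (x⁻¹).b = -x.b := rfl
@[simp] lemma inv_c (x : B θ ε) : (x⁻¹).c =
    -x.c + x.a * θ x.a + x.b * θ x.b + ε * x.a * θ x.b := rfl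

instance : Group (B θ ε) :=
  Group.ofLeftAxioms
    (by intro x y z; ext <;> simp <;> ring)
    (by intro x; ext <;> simp)
    (by intro x; ext <;> simp <;> ring)

end B

/-- The group `C_p(m,θ,ε)`, with underlying set `F × F × F`. -/
@[ext]
structure C (p : ℕ) (θ : RingAut F) (ε : F) where
  a : F
  b : F
  c : F

namespace C

variable {p : ℕ} {θ : RingAut F} {ε : F}

instance : One (C p θ ε) := ⟨⟨0, 0, 0⟩⟩

@[simp] lemma one_a : (1 : C p θ ε).a = 0 := rfl
@[simp] lemma one_b : (1 : C p θ ε).b = 0 := rfl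
@[simp] lemma one_c : (1 : C p θ ε).c = 0 := rfl

variable [Fact p.Prime] [Finite F] [CharP F p]

/-- Here `(frobeniusEquiv F p).symm x` is the `p`-th root `x^{1/p}`. -/
noncomputable instance : Mul (C p θ ε) :=
  ⟨fun x y => ⟨x.a + y.a, x.b + y.b,
    x.c + y.c + x.a * θ y.a + x.b * y.b + ε * (frobeniusEquiv F p).symm x.a * θ (y.b ^ p)⟩⟩
noncomputable instance : Inv (C p θ ε) :=
  ⟨fun x => ⟨-x.a, -x.b,
    -x.c + x.a * θ x.a + x.b * x.b + ε * (frobeniusEquiv F p).symm x.a * θ (x.b ^ p)⟩⟩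

@[simp] lemma mul_a (x y : C p θ ε) : (x * y).a = x.a + y.a := rfl
@[simp] lemma mul_b (x y : C p θ ε) : (x * y).b = x.b + y.b := rfl
@[simp] lemma mul_c (x y : C p θ ε) : (x * y).c =
    x.c + y.c + x.a * θ y.a + x.b * y.b
      + ε * (frobeniusEquiv F p).symm x.a * θ (y.b ^ p) := rfl
@[simp] lemma inv_a (x : C p θ ε) : (x⁻¹).a = -x.a := rfl
@[simp] lemma inv_b (x : C p θ ε) : (x⁻¹).b = -x.b := rfl
@[simp] lemma inv_c (x : C p θ ε) : (x⁻¹).c =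
    -x.c + x.a * θ x.a + x.b * x.b
      + ε * (frobeniusEquiv F p).symm x.a * θ (x.b ^ p) := rfl

noncomputable instance : Group (C p θ ε) :=
  Group.ofLeftAxioms
    (by
      intro x y z
      ext
      · simp; ring
      · simp; ring
      · simp only [mul_a, mul_b, mul_c, map_add, add_pow_char]; ring)
    (by
      intro x
      ext <;> simp)
    (by
      intro x
      ext <;> simp <;> ring)

end C

/-- The group `D_p(m,θ,ε)`, with underlying set `F × F × F`. -/
@[ext]
structure D (θ : RingAut F) (ε : F) where
  a : F
  b : F
  c : F

namespace D

variable {θ : RingAut F} {ε : F}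

instance : Mul (D θ ε) :=
  ⟨fun x y => ⟨x.a + y.a, x.b + y.b,
    x.c + y.c + x.a * θ y.a + x.b * (θ ^ 2) y.b + ε * (θ ^ 3) x.a * θ y.b⟩⟩
instance : One (D θ ε) := ⟨⟨0, 0, 0⟩⟩
instance : Inv (D θ ε) :=
  ⟨fun x => ⟨-x.a, -x.b,
    -x.c + x.a * θ x.a + x.b * (θ ^ 2) x.b + ε * (θ ^ 3) x.a * θ x.b⟩⟩

@[simp] lemma mul_a (x y : D θ ε) : (x * y).a = x.a + y.a := rfl
@[simp] lemma mul_b (x y : D θ ε) : (x * y).b = x.b + y.b := rfl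
@[simp] lemma mul_c (x y : D θ ε) : (x * y).c =
    x.c + y.c + x.a * θ y.a + x.b * (θ ^ 2) y.b + ε * (θ ^ 3) x.a * θ y.b := rfl
@[simp] lemma one_a : (1 : D θ ε).a = 0 := rfl
@[simp] lemma one_b : (1 : D θ ε).b = 0 := rfl
@[simp] lemma one_c : (1 : D θ ε).c = 0 := rfl
@[simp] lemma inv_a (x : D θ ε) : (x⁻¹).a = -x.a := rfl
@[simp] lemma inv_b (x : D θ ε) : (x⁻¹).b = -x.b := rfl
@[simp] lemma inv_c (x : D θ ε) : (x⁻¹).c =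
    -x.c + x.a * θ x.a + x.b * (θ ^ 2) x.b + ε * (θ ^ 3) x.a * θ x.b := rfl

instance : Group (D θ ε) :=
  Group.ofLeftAxioms
    (by intro x y z; ext <;> simp only [mul_a, mul_b, mul_c, map_add] <;> ring)
    (by intro x; ext <;> simp)
    (by intro x; ext <;> simp <;> ring)

end D

end Groups

/-! ### Additive characters of `F` and the quotients `G_v = G ⧸ H_v` -/

section Quotients

variable {F : Type*} [Field F] (p : ℕ) [Fact p.Prime] [Algebra (ZMod p) F]

/-- The additive character `ψ_v(x) = ξ_p ^ Tr(v x)`, `ξ_p = exp(2πi/p)`, with `Tr` the absolute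
trace of `F`. -/
noncomputable def psi (v : F) : AddChar F ℂ :=
  (ZMod.stdAddChar (N := p)).compAddMonoidHom
    ((Algebra.trace (ZMod p) F).toAddMonoidHom.comp (AddMonoidHom.mulLeft v))

lemma psi_eq_stdAddChar (v x : F) :
    psi p v x = ZMod.stdAddChar (Algebra.trace (ZMod p) F (v * x)) := rfl

lemma psi_apply (v x : F) :
    psi p v x =
      Complex.exp (2 * Real.pi * Complex.I / p) ^ (Algebra.trace (ZMod p) F (v * x)).val := by
  have h := ZMod.stdAddChar_coe (N := p) ((Algebra.trace (ZMod p) F (v * x)).val : ℤ)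
  rw [Int.cast_natCast, ZMod.natCast_zmod_val] at h
  rw [psi_eq_stdAddChar, h, ← Complex.exp_nat_mul]
  congr 1
  rw [Int.cast_natCast]
  ring

/-- `H_v = {(0, b) : b ∈ Ker ψ_v}` in `A_p(m,θ)`. -/
def A.H (θ : RingAut F) (v : F) : Subgroup (A θ) where
  carrier := {x | x.a = 0 ∧ psi p v x.b = 1}
  one_mem' := by simp
  mul_mem' := by
    rintro x y ⟨hx, hx'⟩ ⟨hy, hy'⟩
    simp [hx, hy, hx', hy', AddChar.map_add_eq_mul]
  inv_mem' := by
    rintro x ⟨hx, hx'⟩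
    simp [hx, hx', AddChar.map_neg_eq_inv]

instance (θ : RingAut F) (v : F) : (A.H p θ v).Normal := by
  constructor
  rintro x ⟨hx, hx'⟩ g
  have h : g * x * g⁻¹ = x := by
    rw [mul_inv_eq_iff_eq_mul]
    ext <;> simp [hx, add_comm]
  rw [h]
  exact ⟨hx, hx'⟩

/-- `H_v = {(0, 0, c) : c ∈ Ker ψ_v}` in `B_p(m,θ,ε)`. -/
def B.H (θ : RingAut F) (ε v : F) : Subgroup (B θ ε) where
  carrier := {x | x.a = 0 ∧ x.b = 0 ∧ psi p v x.c = 1}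
  one_mem' := by simp
  mul_mem' := by
    rintro x y ⟨hx, hx₂, hx'⟩ ⟨hy, hy₂, hy'⟩
    simp [hx, hy, hx₂, hy₂, hx', hy', AddChar.map_add_eq_mul]
  inv_mem' := by
    rintro x ⟨hx, hx₂, hx'⟩
    simp [hx, hx₂, hx', AddChar.map_neg_eq_inv]

instance (θ : RingAut F) (ε v : F) : (B.H p θ ε v).Normal := by
  constructor
  rintro x ⟨hx, hx₂, hx'⟩ g
  have h : g * x * g⁻¹ = x := by
    rw [mul_inv_eq_iff_eq_mul]
    ext <;> simp [hx, hx₂, add_comm]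
  rw [h]
  exact ⟨hx, hx₂, hx'⟩

/-- `H_v = {(0, 0, c) : c ∈ Ker ψ_v}` in `D_p(m,θ,ε)`. -/
def D.H (θ : RingAut F) (ε v : F) : Subgroup (D θ ε) where
  carrier := {x | x.a = 0 ∧ x.b = 0 ∧ psi p v x.c = 1}
  one_mem' := by simp
  mul_mem' := by
    rintro x y ⟨hx, hx₂, hx'⟩ ⟨hy, hy₂, hy'⟩
    simp [hx, hy, hx₂, hy₂, hx', hy', AddChar.map_add_eq_mul]
  inv_mem' := by
    rintro x ⟨hx, hx₂, hx'⟩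
    simp [hx, hx₂, hx', AddChar.map_neg_eq_inv]

instance (θ : RingAut F) (ε v : F) : (D.H p θ ε v).Normal := by
  constructor
  rintro x ⟨hx, hx₂, hx'⟩ g
  have h : g * x * g⁻¹ = x := by
    rw [mul_inv_eq_iff_eq_mul]
    ext <;> simp [hx, hx₂, add_comm]
  rw [h]
  exact ⟨hx, hx₂, hx'⟩

variable (F) in
/-- The subgroup `F_p^*` of `F^*`. -/
def primeUnits : Subgroup Fˣ := (Units.map (algebraMap (ZMod p) F).toMonoidHom).range

end Quotients

/-! ### The set `I` of linear characters of the centre of `C_p(m,θ,0)` -/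

section SetI

variable {F : Type*} [Field F] (p : ℕ) [Fact p.Prime] [Algebra (ZMod p) F]

/-- For `p` odd: `α^{(v,w)}(0,b,c) = ψ_w(b) ψ_v(c - b²/2)`. -/
noncomputable def alphaOdd (v w b c : F) : ℂ := psi p w b * psi p v (c - 2⁻¹ * b ^ 2)

/-- The function `Q : F → F_2` (used for `p = 2`, `|F| = 2^m`); the parameter `c₀` is only used
for `m` even, where it satisfies `c₀ + c₀^{2^{m/2}} = 1`. -/
noncomputable def Q (m : ℕ) (c₀ x : F) : ZMod p :=
  if Odd m then ∑ i ∈ Finset.range ((m - 1) / 2 + 1), Algebra.trace (ZMod p) F (x ^ (2 ^ i + 1))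
  else (∑ i ∈ Finset.range (m / 2), Algebra.trace (ZMod p) F (x ^ (2 ^ i + 1)))
    + Algebra.trace (ZMod p) F (c₀ * x ^ (2 ^ (m / 2) + 1))

/-- The coefficient `t ∈ F_p` in the decomposition `x = t b₀ + x₁`, where `Tr(b₀) = 1` and
`Tr(x₁) = 0`. -/
noncomputable def tPart (x : F) : ZMod p := Algebra.trace (ZMod p) F x

/-- The component `x₁` in the decomposition `x = t b₀ + x₁`, where `Tr(b₀) = 1` and
`Tr(x₁) = 0`. -/
noncomputable def trPart (b₀ x : F) : F := x - algebraMap (ZMod p) F (tPart p x) * b₀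

lemma decomposition_iff {b₀ : F} (hb₀ : Algebra.trace (ZMod p) F b₀ = 1) (x x₁ : F) (t : ZMod p) :
    (x = algebraMap (ZMod p) F t * b₀ + x₁ ∧ Algebra.trace (ZMod p) F x₁ = 0) ↔
      t = tPart p x ∧ x₁ = trPart p b₀ x := by
  constructor
  · rintro ⟨rfl, h⟩
    have ht : tPart p (algebraMap (ZMod p) F t * b₀ + x₁) = t := by
      simp [tPart, h, ← Algebra.smul_def, hb₀]
    exact ⟨ht.symm, by simp [trPart, ht]⟩
  · rintro ⟨rfl, rfl⟩
    refine ⟨by simp [trPart], ?_⟩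
    simp [trPart, tPart, ← Algebra.smul_def, hb₀]

/-- For `p = 2`: `α^{(v,w,1)}(0,b,c) = i^{κ(t)} (-1)^{Q(b₁) + Tr(t b₀ b₁)} ψ_w(b₁) ψ_v(c)`, where
`v^{2^{m-1}} b = t b₀ + b₁` with `t ∈ F_2` and `Tr(b₁) = 0`. -/
noncomputable def alphaTwo (m : ℕ) (b₀ c₀ v w b c : F) : ℂ :=
  let x := v ^ 2 ^ (m - 1) * b
  let t := tPart p x
  let b₁ := trPart p b₀ x
  Complex.I ^ t.val
    * (-1) ^ (Q p m c₀ b₁ + Algebra.trace (ZMod p) F (algebraMap (ZMod p) F t * b₀ * b₁)).val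
    * psi p w b₁ * psi p v c

variable [Finite F] [CharP F p]

/-- The set `I` for `p` odd: the linear characters `α^{(v,w)}` of the centre of `C_p(m,θ,0)`, one
for each point `[v,w]` with `v ≠ 0` of the projective space of `F²` over `F_p`; `σ` chooses the
representative vector of each point. -/
def IOdd (θ : RingAut F) (σ : Projectivization (ZMod p) (F × F) → F × F) :
    Set (Subgroup.center (C p θ (0 : F)) →* ℂˣ) :=
  {α | ∃ P : Projectivization (ZMod p) (F × F), (σ P).1 ≠ 0 ∧
    ∀ z : Subgroup.center (C p θ (0 : F)),
      (α z : ℂ) = alphaOdd p (σ P).1 (σ P).2 z.1.b z.1.c}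

/-- The set `I` for `p = 2`: the linear characters `α^{(v,w,1)}`, `v ∈ F^*`, `w ∈ F`, of the centre
of `C_2(m,θ,0)` (`α^{(v,w,1)}` depends only on the class of `w` in `F / F_2`). -/
def ITwo (m : ℕ) (θ : RingAut F) (b₀ c₀ : F) :
    Set (Subgroup.center (C p θ (0 : F)) →* ℂˣ) :=
  {α | ∃ v w : F, v ≠ 0 ∧
    ∀ z : Subgroup.center (C p θ (0 : F)),
      (α z : ℂ) = alphaTwo p m b₀ c₀ v w z.1.b z.1.c}

end SetI

end SuzukiP

/-!
By Schur's lemma an irreducible character `χ` of `G` has a central character `lam : Z(G) → ℂˣ`, and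
for a subgroup `N` of the centre, `χ` is the lift of an irreducible character of `G ⧸ N` if and only
if `N` lies in the kernel of `lam` (`exists_centralChar`). Such a character of `G ⧸ N` is unique, so
each part of the theorem says that the given family of central subgroups has exactly one member
inside the kernel of `lam`. If `χ` is not linear, then `lam` is nontrivial on commutators. In all
four types the commutators lie in the last coordinate, a central copy of the additive group of `F`,
and so `lam` restricts there to `ψ_u` with `u ≠ 0` (`exists_ne_zero_eq_psi`).

* In types `A`, `B` and `D` the subgroups are the hyperplanes `Ker ψ_v`, and
  `Ker ψ_v ≤ Ker ψ_u` means that `v` is an `F_p^*`-multiple of `u`, by nondegeneracy of the trace.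
* In type `C` with `p` odd, `(b, c) ↦ (b, c - b² / 2)` identifies the centre with `F²`. Then `lam`
  becomes a pair of trace forms, which its kernel determines up to a factor in `F_p^*`, that is, as
  a point of projective space.
* In type `C` with `p = 2` the centre has exponent `4` and the image of `lam` is the group of fourth
  roots of unity, so that exactly `lam` and `lam⁻¹` share the kernel of `lam`. With `u = v` as above
  and `v^{2^{m-1}} b = b₀`, the value of `lam` at `(0, b, 0)` is a square root of
  `ψ_v(b²) = (-1)^{Tr b₀} = -1`. The set `I` consists of the characters for which this value is `i`
  rather than `-i`, so it contains precisely one of `lam`, `lam⁻¹`. That the formula for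
  `α^{(v,w,1)}` defines a character rests on `Q(x + y) = Q(x) + Q(y) + Tr(xy)` for `x`, `y` of
  trace zero (`Q_add`, `alphaTwo_mul`).
-/

namespace SuzukiP

open scoped commutatorElement

/-! ### Central characters and lifting -/

section Lifting

variable {G : Type*} [Group G]

lemma lift_injective (N : Subgroup G) [N.Normal] : Function.Injective (lift N) := by
  intro φ φ' h
  funext x
  induction x using QuotientGroup.induction_on with
  | H g => exact congrFun h g

lemma isIrreducible_comp_mk_iff (N : Subgroup G) [N.Normal] {V : Type*} [AddCommGroup V]
    [Module ℂ V] (ρ : Representation ℂ (G ⧸ N) V) :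
    (show Representation ℂ G V from ρ.comp (QuotientGroup.mk' N)).IsIrreducible ↔
      ρ.IsIrreducible := by
  refine OrderIso.isSimpleOrder_iff
    { toFun := fun W => ⟨W.toSubmodule, fun g v hv => ?_⟩
      invFun := fun W => ⟨W.toSubmodule, fun g v hv => W.apply_mem_toSubmodule (g : G ⧸ N) hv⟩
      left_inv := fun _ => rfl
      right_inv := fun _ => rfl
      map_rel_iff' := Iff.rfl }
  induction g using QuotientGroup.induction_on with
  | H g => exact W.apply_mem_toSubmodule g hv

lemma exists_lift_eq_character (N : Subgroup G) [N.Normal] {d : ℕ}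
    (ρ : Representation ℂ G (Fin d → ℂ)) [hρ : ρ.IsIrreducible] (hN : ∀ n ∈ N, ρ n = 1) :
    ∃ φ : G ⧸ N → ℂ, IsIrrChar φ ∧ lift N φ = ρ.character := by
  let ρ' : Representation ℂ (G ⧸ N) (Fin d → ℂ) := QuotientGroup.lift N ρ hN
  exact ⟨ρ'.character, ⟨d, ρ', (isIrreducible_comp_mk_iff N ρ').1 hρ, rfl⟩, rfl⟩

/-- Schur's lemma: the centre acts by scalars in an irreducible representation. -/
lemma exists_central_scalar {d : ℕ} (ρ : Representation ℂ G (Fin d → ℂ)) [ρ.IsIrreducible] :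
    ∃ lam : Subgroup.center G →* ℂˣ, ∀ z : Subgroup.center G,
      ρ z = (lam z : ℂ) • (1 : Module.End ℂ (Fin d → ℂ)) := by
  have hne : Nontrivial (Fin d → ℂ) := by
    by_contra h
    rw [not_nontrivial_iff_subsingleton] at h
    obtain ⟨a, b, hab⟩ := exists_pair_ne (Subrepresentation ρ)
    exact hab (Subrepresentation.toSubmodule_injective (Subsingleton.elim _ _))
  have key : ∀ z : Subgroup.center G, ∃ c : ℂ, ρ z = c • (1 : Module.End ℂ (Fin d → ℂ)) := by
    intro z
    let f : Representation.IntertwiningMap ρ ρ := ⟨ρ z, fun g => by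
      have h := Subgroup.mem_center_iff.mp z.2 g
      change ρ z * ρ g = ρ g * ρ z
      rw [← map_mul, ← map_mul, h]⟩
    obtain ⟨c, hc⟩ :=
      (Representation.IsIrreducible.algebraMap_intertwiningMap_bijective_of_isAlgClosed
        (ρ := ρ)).2 f
    refine ⟨c, ?_⟩
    have := congrArg (fun f : Representation.IntertwiningMap ρ ρ => f.toLinearMap) hc
    exact this.symm
  choose c hc using key
  have hinj : ∀ a b : ℂ, a • (1 : Module.End ℂ (Fin d → ℂ)) = b • 1 → a = b := fun a b h =>
    smul_left_injective ℂ (one_ne_zero (α := Module.End ℂ (Fin d → ℂ))) h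
  let lam : Subgroup.center G →* ℂ :=
    { toFun := c
      map_one' := hinj _ _ (by rw [← hc]; simp)
      map_mul' := fun x y => hinj _ _ (by
        rw [← hc, Subgroup.coe_mul, map_mul, hc, hc, smul_mul_smul_comm, one_mul]) }
  exact ⟨lam.toHomUnits, hc⟩

lemma mem_centerKer {α : Subgroup.center G →* ℂˣ} {g : G} :
    g ∈ centerKer α ↔ ∃ h : g ∈ Subgroup.center G, α ⟨g, h⟩ = 1 := by
  constructor
  · rintro ⟨z, hz, rfl⟩
    exact ⟨z.2, hz⟩
  · rintro ⟨h, hg⟩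
    exact ⟨⟨g, h⟩, hg, rfl⟩

lemma coe_mem_centerKer {α : Subgroup.center G →* ℂˣ} {z : Subgroup.center G} :
    (z : G) ∈ centerKer α ↔ α z = 1 := by
  simp [mem_centerKer]

lemma centerKer_le_iff {α β : Subgroup.center G →* ℂˣ} :
    centerKer α ≤ centerKer β ↔ ∀ z, α z = 1 → β z = 1 := by
  constructor
  · intro h z hz
    exact coe_mem_centerKer.1 (h (coe_mem_centerKer.2 hz))
  · rintro h _ ⟨z, hz, rfl⟩
    exact ⟨z, h z hz, rfl⟩

lemma centerKer_le_center (α : Subgroup.center G →* ℂˣ) : centerKer α ≤ Subgroup.center G := by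
  rintro _ ⟨z, -, rfl⟩
  exact z.2

/-- The central character `lam` of a non-linear irreducible character `χ` decides from which
central quotients `χ` is lifted; it is nontrivial on the commutator subgroup. -/
theorem exists_centralChar {χ : G → ℂ} (hχ : χ ∈ Irr1 G) :
    ∃ lam : Subgroup.center G →* ℂˣ, ¬ commutator G ≤ centerKer lam ∧
      ∀ (N : Subgroup G) [N.Normal], N ≤ Subgroup.center G →
        ((∃ φ : Irr1 (G ⧸ N), lift N φ.1 = χ) ↔ N ≤ centerKer lam) := by
  obtain ⟨⟨d, ρ, hρ, rfl⟩, h1⟩ := hχ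
  obtain ⟨lam, hlam⟩ := exists_central_scalar ρ
  have hdeg : ρ.character 1 = d := by simp
  -- an irreducible representation is nonzero, so that `lam n` can be read off from `χ n`
  have hd : (d : ℂ) ≠ 0 := by
    intro h
    have h0 : d = 0 := by exact_mod_cast h
    subst h0
    obtain ⟨a, b, hab⟩ := exists_pair_ne (Subrepresentation ρ)
    exact hab (Subrepresentation.toSubmodule_injective (Subsingleton.elim _ _))
  have hone : ∀ z : Subgroup.center G, lam z = 1 → ρ z = 1 := fun z hz => by simp [hlam, hz]
  have hex : ∀ (N : Subgroup G) [N.Normal], N ≤ centerKer lam →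
      ∃ φ : Irr1 (G ⧸ N), lift N φ.1 = ρ.character := by
    intro N _ hN
    obtain ⟨φ, hφ, h⟩ := exists_lift_eq_character N ρ fun n hn => by
      obtain ⟨hn', hz⟩ := mem_centerKer.1 (hN hn)
      exact hone _ hz
    refine ⟨⟨φ, hφ, ?_⟩, h⟩
    rw [← h] at h1
    exact h1
  refine ⟨lam, fun hcomm => ?_, fun N _ hN => ⟨?_, hex N⟩⟩
  · obtain ⟨⟨φ, hφ, hφ1⟩, -⟩ := hex _ le_rfl
    obtain ⟨e, τ, hτ, rfl⟩ := hφ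
    have : IsMulCommutative (G ⧸ centerKer lam) :=
      Subgroup.Normal.quotient_commutative_iff_commutator_le.2 hcomm
    have := Representation.IsIrreducible.finrank_eq_one_of_isMulCommutative τ
    exact hφ1 (by rw [Representation.char_one, this, Nat.cast_one])
  · rintro ⟨φ, hφ⟩ n hn
    refine mem_centerKer.2 ⟨hN hn, ?_⟩
    have h : ρ.character n = ρ.character 1 := by
      rw [← hφ]
      simp only [lift]
      rw [(QuotientGroup.eq_one_iff n).2 hn, QuotientGroup.mk_one]
    have h2 : ρ.character n = (lam ⟨n, hN hn⟩ : ℂ) * d := by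
      simp [Representation.character, show ρ n = _ from hlam ⟨n, hN hn⟩]
    rw [h2, hdeg] at h
    exact Units.ext (mul_right_cancel₀ hd (by simpa using h))

/-- For a family of central subgroups, unique lifting of `χ` reduces to the existence of a unique
member of the family inside the kernel of the central character. -/
theorem exists_centralChar_existsUnique {χ : G → ℂ} (hχ : χ ∈ Irr1 G) :
    ∃ lam : Subgroup.center G →* ℂˣ, ¬ commutator G ≤ centerKer lam ∧
      ∀ {ι : Type _} (N : ι → Subgroup G) [∀ i, (N i).Normal], (∀ i, N i ≤ Subgroup.center G) →
        (∃! i, N i ≤ centerKer lam) →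
        ∃! x : (i : ι) × Irr1 (G ⧸ N i), lift (N x.1) x.2.1 = χ := by
  obtain ⟨lam, hcomm, h⟩ := exists_centralChar hχ
  refine ⟨lam, hcomm, fun N _ hN => ?_⟩
  rintro ⟨i, hi, huniq⟩
  obtain ⟨φ, hφ⟩ := (h (N i) (hN i)).2 hi
  refine ⟨⟨i, φ⟩, hφ, ?_⟩
  rintro ⟨j, φ'⟩ hφ'
  obtain rfl := huniq j ((h (N j) (hN j)).1 ⟨φ', hφ'⟩)
  congr 1
  exact Subtype.ext (lift_injective _ (hφ'.trans hφ.symm))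

end Lifting

/-! ### Additive characters of a finite field -/

section Additive

variable {F : Type*} [Field F] (p : ℕ) [Fact p.Prime] [Algebra (ZMod p) F]

lemma psi_eq_one_iff (v x : F) : psi p v x = 1 ↔ Algebra.trace (ZMod p) F (v * x) = 0 := by
  rw [psi_eq_stdAddChar, ← AddChar.map_zero_eq_one (ZMod.stdAddChar (N := p)),
    ZMod.injective_stdAddChar.eq_iff]

variable [Finite F]

variable {p} in
/-- A pair of trace forms is determined up to an `F_p`-multiple by its kernel. -/
lemma exists_smul_eq_of_trace_ker_le {v w v' w' : F}
    (h : ∀ x y : F, Algebra.trace (ZMod p) F (v * x) + Algebra.trace (ZMod p) F (w * y) = 0 →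
      Algebra.trace (ZMod p) F (v' * x) + Algebra.trace (ZMod p) F (w' * y) = 0) :
    ∃ c : ZMod p, (v', w') = c • (v, w) := by
  let L : F → F → (F × F →ₗ[ZMod p] ZMod p) := fun v w =>
    (Algebra.traceForm (ZMod p) F v).coprod (Algebra.traceForm (ZMod p) F w)
  have hker : ⨅ _ : Unit, LinearMap.ker (L v w) ≤ LinearMap.ker (L v' w') := by
    rw [iInf_const]
    rintro ⟨x, y⟩ hxy
    exact h x y hxy
  have hspan := mem_span_of_iInf_ker_le_ker hker
  rw [Set.range_const, Submodule.mem_span_singleton] at hspan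
  obtain ⟨c, hc⟩ := hspan
  have hinj : Function.Injective (Algebra.traceForm (ZMod p) F) :=
    LinearMap.BilinForm.nondegenerate_iff_ker_eq_bot.1 (traceForm_nondegenerate (ZMod p) F) |>
      LinearMap.ker_eq_bot.1
  refine ⟨c, Prod.ext (hinj ?_) (hinj ?_)⟩
  · ext x
    have := LinearMap.congr_fun hc (x, 0)
    simpa [L] using this.symm
  · ext x
    have := LinearMap.congr_fun hc (0, x)
    simpa [L] using this.symm

variable {p} in
lemma exists_smul_eq_of_psi_ker_le {u v : F} (h : ∀ x, psi p v x = 1 → psi p u x = 1) :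
    ∃ c : ZMod p, u = c • v := by
  obtain ⟨c, hc⟩ := exists_smul_eq_of_trace_ker_le (p := p) (v := v) (w := 0) (v' := u) (w' := 0)
    fun x y hxy => by
      simp only [zero_mul, map_zero, add_zero] at hxy ⊢
      exact (psi_eq_one_iff p u x).1 (h x ((psi_eq_one_iff p v x).2 hxy))
  exact ⟨c, congrArg Prod.fst hc⟩

lemma psi_injective : Function.Injective (psi p : F → AddChar F ℂ) := by
  intro u v h
  have hnd := (traceForm_nondegenerate (ZMod p) F).1 (u - v)
  refine sub_eq_zero.1 (hnd fun x => ?_)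
  have := DFunLike.congr_fun h x
  rw [psi_eq_stdAddChar, psi_eq_stdAddChar, ZMod.injective_stdAddChar.eq_iff] at this
  simp [Algebra.traceForm_apply, this]

lemma psi_surjective : Function.Surjective (psi p : F → AddChar F ℂ) := by
  have := Fintype.ofFinite F
  exact ((Fintype.bijective_iff_injective_and_card _).2
    ⟨psi_injective p, AddChar.card_eq.symm⟩).2

lemma exists_eq_psi (f : F → ℂ) (h0 : f 0 = 1) (hadd : ∀ x y, f (x + y) = f x * f y) :
    ∃ v, ∀ x, f x = psi p v x := by
  obtain ⟨v, hv⟩ := psi_surjective p (⟨f, h0, hadd⟩ : AddChar F ℂ)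
  exact ⟨v, fun x => by rw [hv]; rfl⟩

end Additive

/-! ### Groups with a central copy of the additive group containing the commutators -/

section CentralCopy

variable {F : Type*} [Field F] [Finite F] {p : ℕ} [Fact p.Prime] [Algebra (ZMod p) F]

/-- If `T` represents the classes of `F^*` modulo `F_p^*`, then exactly one of the hyperplanes
`Ker ψ_v`, `v ∈ T`, lies in `Ker ψ_u`, for every `u ≠ 0`. -/
lemma existsUnique_psi_ker_le {T : Set Fˣ}
    (hT : Subgroup.IsComplement T (primeUnits F p : Set Fˣ)) {u : F} (hu : u ≠ 0) :
    ∃! v : T, ∀ x, psi p ((v : Fˣ) : F) x = 1 → psi p u x = 1 := by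
  have hiff : ∀ v : Fˣ, (∀ x, psi p (v : F) x = 1 → psi p u x = 1) ↔
      v⁻¹ * Units.mk0 u hu ∈ primeUnits F p := by
    intro v
    constructor
    · intro h
      obtain ⟨c, hc⟩ := exists_smul_eq_of_psi_ker_le h
      have hc0 : c ≠ 0 := by rintro rfl; exact hu (by simpa using hc)
      refine ⟨Units.mk0 c hc0, eq_inv_mul_of_mul_eq (Units.ext ?_)⟩
      simp [hc, Algebra.smul_def, mul_comm]
    · rintro ⟨c, hc⟩ x hx
      have hu' : u = (c : ZMod p) • (v : F) := by
        have := congrArg Units.val (mul_eq_of_eq_inv_mul hc)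
        simpa [Algebra.smul_def, mul_comm] using this.symm
      rw [psi_eq_one_iff] at hx ⊢
      rw [hu', smul_mul_assoc, map_smul, hx, smul_zero]
  simp_rw [hiff]
  exact Subgroup.isComplement_iff_existsUnique_inv_mul_mem.1 hT _

variable {G : Type*} [Group G]

/-- A central character that is nontrivial on commutators restricts to some `ψ_u`, `u ≠ 0`, on a
central copy `ζ` of the additive group of `F` containing all commutators. -/
lemma exists_ne_zero_eq_psi (p : ℕ) [Fact p.Prime] [Algebra (ZMod p) F] {ζ : F → G}
    (hζ0 : ζ 0 = 1)
    (hζ : ∀ x y, ζ (x + y) = ζ x * ζ y) (hζc : ∀ x, ζ x ∈ Subgroup.center G)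
    (hcomm : ∀ g h, ∃ x, g * h = ζ x * (h * g))
    {lam : Subgroup.center G →* ℂˣ} (hlam : ¬ commutator G ≤ centerKer lam) :
    ∃ u : F, u ≠ 0 ∧ ∀ x, (lam ⟨ζ x, hζc x⟩ : ℂ) = psi p u x := by
  obtain ⟨u, hu⟩ := exists_eq_psi p (fun x => (lam ⟨ζ x, hζc x⟩ : ℂ))
    (by
      have : (⟨ζ 0, hζc 0⟩ : Subgroup.center G) = 1 := Subtype.ext hζ0
      simp [this])
    (fun x y => by
      have : (⟨ζ (x + y), hζc _⟩ : Subgroup.center G) = ⟨ζ x, hζc x⟩ * ⟨ζ y, hζc y⟩ :=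
        Subtype.ext (hζ x y)
      rw [this, map_mul, Units.val_mul])
  refine ⟨u, ?_, hu⟩
  rintro rfl
  refine hlam (Subgroup.commutator_le.2 fun g _ h _ => ?_)
  obtain ⟨x, hx⟩ := hcomm g h
  have hgh : ⁅g, h⁆ = ζ x := by
    rw [commutatorElement_def, hx]
    group
  refine mem_centerKer.2 ⟨hgh ▸ hζc x, ?_⟩
  have h1 := hu x
  rw [(psi_eq_one_iff p 0 x).2 (by simp), Units.val_eq_one] at h1
  simpa only [hgh] using h1

/-- The common form of the statements for types `A`, `B` and `D`: here `ζ` parametrizes the last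
coordinate of the group. -/
theorem existsUnique_lift_of_central (ζ : F → G) (hζ0 : ζ 0 = 1)
    (hζ : ∀ x y, ζ (x + y) = ζ x * ζ y) (hζc : ∀ x, ζ x ∈ Subgroup.center G)
    (hcomm : ∀ g h, ∃ x, g * h = ζ x * (h * g))
    (H : F → Subgroup G) [∀ v, (H v).Normal]
    (hH : ∀ v g, g ∈ H v ↔ ∃ x, psi p v x = 1 ∧ ζ x = g)
    {T : Set Fˣ} (hT : Subgroup.IsComplement T (primeUnits F p : Set Fˣ))
    {χ : G → ℂ} (hχ : χ ∈ Irr1 G) :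
    ∃! x : (v : T) × Irr1 (G ⧸ H ((v : Fˣ) : F)), lift (H ((x.1 : Fˣ) : F)) x.2.1 = χ := by
  obtain ⟨lam, hlam, h⟩ := exists_centralChar_existsUnique hχ
  obtain ⟨u, hu0, hu⟩ := exists_ne_zero_eq_psi p hζ0 hζ hζc hcomm hlam
  have hmem : ∀ x, ζ x ∈ centerKer lam ↔ psi p u x = 1 := fun x => by
    rw [← hu x, Units.val_eq_one, ← coe_mem_centerKer]
  refine h (fun v : T => H ((v : Fˣ) : F)) (fun v g hg => ?_) ?_
  · obtain ⟨x, -, rfl⟩ := (hH _ g).1 hg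
    exact hζc x
  · obtain ⟨v, hv, huniq⟩ := existsUnique_psi_ker_le hT hu0
    have hle : ∀ v : F, H v ≤ centerKer lam ↔ ∀ x, psi p v x = 1 → psi p u x = 1 := by
      intro v
      constructor
      · intro h x hx
        exact (hmem x).1 (h ((hH v _).2 ⟨x, hx, rfl⟩))
      · intro h g hg
        obtain ⟨x, hx, rfl⟩ := (hH v g).1 hg
        exact (hmem x).2 (h x hx)
    exact ⟨v, (hle _).2 hv, fun w hw => huniq w ((hle _).1 hw)⟩

end CentralCopy

section TypesABD

variable {F : Type*} [Field F] [Finite F] {p : ℕ} [Fact p.Prime] [Algebra (ZMod p) F]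
  (θ : RingAut F) {T : Set Fˣ} (hT : Subgroup.IsComplement T (primeUnits F p : Set Fˣ))

include hT

theorem A.existsUnique_lift {χ : A θ → ℂ} (hχ : χ ∈ Irr1 (A θ)) :
    ∃! x : (v : T) × Irr1 (A θ ⧸ A.H p θ ((v : Fˣ) : F)),
      lift (A.H p θ ((x.1 : Fˣ) : F)) x.2.1 = χ := by
  refine existsUnique_lift_of_central (fun x => (⟨0, x⟩ : A θ)) rfl ?_ ?_ ?_ (A.H p θ) ?_ hT hχ
  · intro x y; ext <;> simp
  · intro x
    rw [Subgroup.mem_center_iff]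
    intro g; ext <;> simp [add_comm]
  · intro g h
    refine ⟨g.a * θ h.a - h.a * θ g.a, ?_⟩
    ext
    · simp [add_comm]
    · simp; ring
  · intro v g
    constructor
    · rintro ⟨h1, h2⟩
      exact ⟨g.b, h2, by ext <;> simp [h1]⟩
    · rintro ⟨x, hx, rfl⟩
      exact ⟨rfl, hx⟩

theorem B.existsUnique_lift {χ : B θ (0 : F) → ℂ} (hχ : χ ∈ Irr1 (B θ (0 : F))) :
    ∃! x : (v : T) × Irr1 (B θ (0 : F) ⧸ B.H p θ 0 ((v : Fˣ) : F)),
      lift (B.H p θ 0 ((x.1 : Fˣ) : F)) x.2.1 = χ := by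
  refine existsUnique_lift_of_central (fun x => (⟨0, 0, x⟩ : B θ 0)) rfl ?_ ?_ ?_ (B.H p θ 0) ?_
    hT hχ
  · intro x y; ext <;> simp
  · intro x
    rw [Subgroup.mem_center_iff]
    intro g; ext <;> simp [add_comm]
  · intro g h
    refine ⟨g.a * θ h.a + g.b * θ h.b - h.a * θ g.a - h.b * θ g.b, ?_⟩
    ext
    · simp [add_comm]
    · simp [add_comm]
    · simp; ring
  · intro v g
    constructor
    · rintro ⟨h1, h2, h3⟩
      exact ⟨g.c, h3, by ext <;> simp [h1, h2]⟩
    · rintro ⟨x, hx, rfl⟩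
      exact ⟨rfl, rfl, hx⟩

theorem D.existsUnique_lift {χ : D θ (0 : F) → ℂ} (hχ : χ ∈ Irr1 (D θ (0 : F))) :
    ∃! x : (v : T) × Irr1 (D θ (0 : F) ⧸ D.H p θ 0 ((v : Fˣ) : F)),
      lift (D.H p θ 0 ((x.1 : Fˣ) : F)) x.2.1 = χ := by
  refine existsUnique_lift_of_central (fun x => (⟨0, 0, x⟩ : D θ 0)) rfl ?_ ?_ ?_ (D.H p θ 0) ?_
    hT hχ
  · intro x y; ext <;> simp
  · intro x
    rw [Subgroup.mem_center_iff]
    intro g; ext <;> simp [add_comm]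
  · intro g h
    refine ⟨g.a * θ h.a + g.b * (θ ^ 2) h.b - h.a * θ g.a - h.b * (θ ^ 2) g.b, ?_⟩
    ext
    · simp [add_comm]
    · simp [add_comm]
    · simp; ring
  · intro v g
    constructor
    · rintro ⟨h1, h2, h3⟩
      exact ⟨g.c, h3, by ext <;> simp [h1, h2]⟩
    · rintro ⟨x, hx, rfl⟩
      exact ⟨rfl, rfl, hx⟩

end TypesABD

/-! ### The centre of the groups of type `C` -/

section TypeC

variable {F : Type*} [Field F] [Finite F] {p : ℕ} [Fact p.Prime] [CharP F p]
  {θ : RingAut F}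

variable (p θ) in
/-- The central element `(0, b, c)` of `C_p(m,θ,0)`. -/
def C.central (b c : F) : Subgroup.center (C p θ (0 : F)) :=
  ⟨⟨0, b, c⟩, Subgroup.mem_center_iff.2 fun g => by ext <;> simp [add_comm, mul_comm]⟩

@[simp] lemma C.coe_central (b c : F) : (C.central p θ b c : C p θ (0 : F)) = ⟨0, b, c⟩ := rfl

lemma C.central_mul (b c e f : F) :
    C.central p θ b c * C.central p θ e f = C.central p θ (b + e) (c + f + b * e) := by
  ext <;> simp

lemma C.central_zero : C.central p θ 0 0 = 1 := rfl

/-- As `θ ≠ 1`, the centre is no larger than `{(0, b, c)}`. -/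
lemma C.a_eq_zero (hθ : θ ≠ 1) (z : Subgroup.center (C p θ (0 : F))) :
    (z : C p θ (0 : F)).a = 0 := by
  have hz : ∀ d : F, d * θ z.1.a = z.1.a * θ d := fun d => by
    simpa [add_comm] using congrArg C.c (Subgroup.mem_center_iff.1 z.2 ⟨d, 0, 0⟩)
  have hfix : θ z.1.a = z.1.a := by simpa using hz 1
  by_contra ha
  refine hθ (RingEquiv.ext fun d => ?_)
  have h := hz d
  rw [hfix, mul_comm] at h
  exact (mul_left_cancel₀ ha h).symm

lemma C.eq_central (hθ : θ ≠ 1) (z : Subgroup.center (C p θ (0 : F))) :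
    z = C.central p θ z.1.b z.1.c :=
  Subtype.ext (C.ext (C.a_eq_zero hθ z) rfl rfl)

/-- A function of `(b, c)` that respects the multiplication of the centre is a linear character. -/
lemma C.exists_center_hom (hθ : θ ≠ 1) (f : F → F → ℂ) (h0 : f 0 0 = 1)
    (hf : ∀ b c e d, f (b + e) (c + d + b * e) = f b c * f e d) :
    ∃ α : Subgroup.center (C p θ (0 : F)) →* ℂˣ, ∀ z, (α z : ℂ) = f z.1.b z.1.c := by
  let α : Subgroup.center (C p θ (0 : F)) →* ℂ :=
    { toFun := fun z => f z.1.b z.1.c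
      map_one' := h0
      map_mul' := fun x y => by
        rw [← hf]
        simp [C.a_eq_zero hθ x] }
  exact ⟨α.toHomUnits, fun _ => rfl⟩

variable [Algebra (ZMod p) F]

lemma C.exists_ne_zero_eq_psi {lam : Subgroup.center (C p θ (0 : F)) →* ℂˣ}
    (hlam : ¬ commutator (C p θ (0 : F)) ≤ centerKer lam) :
    ∃ v : F, v ≠ 0 ∧ ∀ c, (lam (C.central p θ 0 c) : ℂ) = psi p v c := by
  refine SuzukiP.exists_ne_zero_eq_psi p (ζ := fun c => (C.central p θ 0 c : C p θ (0 : F)))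
    rfl ?_ (fun c => (C.central p θ 0 c).2) ?_ hlam
  · intro x y; ext <;> simp
  · intro g h
    refine ⟨g.a * θ h.a - h.a * θ g.a, ?_⟩
    ext
    · simp [add_comm]
    · simp [add_comm]
    · simp; ring

/-! ### Type `C` in odd characteristic -/

omit [Finite F] [CharP F p] in
lemma alphaOdd_eq_one_iff (v w b c : F) : alphaOdd p v w b c = 1 ↔
    Algebra.trace (ZMod p) F (v * (c - 2⁻¹ * b ^ 2)) + Algebra.trace (ZMod p) F (w * b) = 0 := by
  rw [alphaOdd, psi_eq_stdAddChar, psi_eq_stdAddChar, ← AddChar.map_add_eq_mul, add_comm,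
    ← AddChar.map_zero_eq_one (ZMod.stdAddChar (N := p)), ZMod.injective_stdAddChar.eq_iff]

theorem C.existsUnique_lift_odd (hθ : θ ≠ 1) (hp : p ≠ 2)
    {σ : Projectivization (ZMod p) (F × F) → F × F}
    (hσ : ∀ P, ∃ h : σ P ≠ 0, Projectivization.mk (ZMod p) (σ P) h = P)
    {χ : C p θ (0 : F) → ℂ} (hχ : χ ∈ Irr1 (C p θ (0 : F))) :
    ∃! x : (α : IOdd p θ σ) × Irr1 (C p θ (0 : F) ⧸ centerKer α.1),
      lift (centerKer x.1.1) x.2.1 = χ := by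
  have h2 : (2 : F) ≠ 0 := Ring.two_ne_zero (by rwa [ringChar.eq F p])
  obtain ⟨lam, hlam, hmain⟩ := exists_centralChar_existsUnique hχ
  obtain ⟨v, hv0, hv⟩ := C.exists_ne_zero_eq_psi hlam
  -- `b ↦ (0, b, b² / 2)` is a homomorphism, which splits off the second coordinate
  obtain ⟨w, hw⟩ := exists_eq_psi p (fun b : F => (lam (C.central p θ b (2⁻¹ * b ^ 2)) : ℂ))
    (by simp [C.central_zero])
    (fun b e => by
      rw [← Units.val_mul, ← map_mul, C.central_mul]
      congr 3
      field_simp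
      ring)
  have hlam_eq : ∀ z, (lam z : ℂ) = alphaOdd p v w z.1.b z.1.c := by
    intro z
    conv_lhs => rw [C.eq_central hθ z]
    rw [alphaOdd, ← hv, ← hw, ← Units.val_mul, ← map_mul, C.central_mul]
    congr 3 <;> ring
  have hker : ∀ {α : Subgroup.center (C p θ (0 : F)) →* ℂˣ} {v' w' : F},
      (∀ z, (α z : ℂ) = alphaOdd p v' w' z.1.b z.1.c) →
      (centerKer α ≤ centerKer lam ↔ ∃ k : ZMod p, (v, w) = k • (v', w')) := by
    intro α v' w' hα
    simp_rw [centerKer_le_iff, ← Units.val_eq_one, hα, hlam_eq, alphaOdd_eq_one_iff]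
    constructor
    · intro h
      refine exists_smul_eq_of_trace_ker_le fun x y hxy => ?_
      have := h (C.central p θ y (x + 2⁻¹ * y ^ 2))
      simp only [C.coe_central, add_sub_cancel_right] at this
      exact this hxy
    · rintro ⟨k, hk⟩ z hz
      obtain ⟨rfl, rfl⟩ := Prod.ext_iff.1 hk
      simp only [Prod.smul_mk, smul_mul_assoc, map_smul, ← smul_add, hz, smul_zero]
  refine hmain (fun α : IOdd p θ σ => centerKer α.1) (fun α => centerKer_le_center α.1) ?_
  have hvw : (v, w) ≠ 0 := fun h => hv0 (congrArg Prod.fst h)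
  obtain ⟨hP0, hP⟩ := hσ (Projectivization.mk (ZMod p) (v, w) hvw)
  obtain ⟨k, hk⟩ := (Projectivization.mk_eq_mk_iff _ _ _ hvw hP0).1 hP.symm
  set s := σ (Projectivization.mk (ZMod p) (v, w) hvw)
  obtain ⟨α, hα⟩ := C.exists_center_hom (p := p) hθ (alphaOdd p s.1 s.2)
    (by simp [alphaOdd])
    (fun b c e d => by
      have : c + d + b * e - 2⁻¹ * (b + e) ^ 2 = (c - 2⁻¹ * b ^ 2) + (d - 2⁻¹ * e ^ 2) := by
        field_simp
        ring
      rw [alphaOdd, this, AddChar.map_add_eq_mul, AddChar.map_add_eq_mul, alphaOdd, alphaOdd]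
      ring)
  refine ⟨⟨α, _, fun h0 => ?_, hα⟩, (hker hα).2 ⟨k, hk.symm⟩, ?_⟩
  · exact hv0 ((congrArg Prod.fst hk).symm.trans ((congrArg (k • ·) h0).trans (smul_zero k)))
  · rintro ⟨β, P', hP', hβ⟩ hle
    obtain ⟨k', hk'⟩ := (hker hβ).1 hle
    obtain ⟨h0', hmk⟩ := hσ P'
    have hPP : P' = Projectivization.mk (ZMod p) (v, w) hvw := by
      rw [← hmk, eq_comm, Projectivization.mk_eq_mk_iff']
      exact ⟨k', hk'.symm⟩
    subst hPP
    refine Subtype.ext (MonoidHom.ext fun z => Units.ext ?_)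
    exact (hβ z).trans (hα z).symm

end TypeC

/-! ### The quadratic form `Q` in characteristic two -/

section CharTwo

open Finset

variable {F : Type*} [Field F] [Finite F] [CharP F 2] [Algebra (ZMod 2) F]
  {m : ℕ}

local notation "Tr" => Algebra.trace (ZMod 2) F

omit [CharP F 2] [Algebra (ZMod 2) F] in
lemma pow_two_pow_eq_self (hF : Nat.card F = 2 ^ m) (x : F) : x ^ 2 ^ m = x := by
  have := Fintype.ofFinite F
  rw [← hF, Nat.card_eq_fintype_card, FiniteField.pow_card]

omit [Finite F] [CharP F 2] in
lemma trace_algebraMap_mul (t : ZMod 2) (x : F) : Tr (algebraMap (ZMod 2) F t * x) = t * Tr x := by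
  rw [← Algebra.smul_def, map_smul, smul_eq_mul]

omit [CharP F 2] in
lemma trace_sq (x : F) : Tr (x ^ 2) = Tr x := by
  have := Algebra.trace_eq_of_algEquiv (FiniteField.frobeniusAlgEquivOfAlgebraic (ZMod 2) F) x
  simpa [FiniteField.coe_frobeniusAlgEquivOfAlgebraic] using this

omit [CharP F 2] in
lemma trace_pow_two_pow (x : F) (i : ℕ) : Tr (x ^ 2 ^ i) = Tr x := by
  induction i with
  | zero => simp
  | succ i ih => rw [pow_succ, pow_mul, trace_sq, ih]

omit [CharP F 2] in
/-- For `Tr x = 0` the sum of all conjugates of `x` vanishes. -/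
lemma sum_trace_pow_mul (hF : Nat.card F = 2 ^ m) {x : F} (hx : Tr x = 0) (y : F) :
    ∑ i ∈ range m, Tr (x ^ 2 ^ i * y) = 0 := by
  have hm : Module.finrank (ZMod 2) F = m := by
    have h := Module.natCard_eq_pow_finrank (K := ZMod 2) (V := F)
    rw [hF, Nat.card_zmod] at h
    exact (Nat.pow_right_injective le_rfl h).symm
  have h := FiniteField.algebraMap_trace_eq_sum_pow (ZMod 2) F x
  rw [hx, map_zero, hm, Nat.card_zmod] at h
  rw [← map_sum, ← sum_mul, ← h, zero_mul, map_zero]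

omit [CharP F 2] in
/-- `Tr(x y^{2^i}) = Tr(x^{2^{m-i}} y)`. -/
lemma trace_mul_pow (hF : Nat.card F = 2 ^ m) (x y : F) {i : ℕ} (hi : i ≤ m) :
    Tr (y ^ 2 ^ i * x) = Tr (x ^ 2 ^ (m - i) * y) := by
  rw [← trace_pow_two_pow _ (m - i), mul_pow, ← pow_mul, ← pow_add, Nat.add_sub_cancel' hi,
    pow_two_pow_eq_self hF, mul_comm]

lemma trace_add_pow (hF : Nat.card F = 2 ^ m) (x y : F) {i : ℕ} (hi : i ≤ m) :
    Tr ((x + y) ^ (2 ^ i + 1)) = Tr (x ^ (2 ^ i + 1)) + Tr (y ^ (2 ^ i + 1)) +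
      (Tr (x ^ 2 ^ i * y) + Tr (x ^ 2 ^ (m - i) * y)) := by
  rw [← trace_mul_pow hF x y hi, ← map_add, ← map_add, ← map_add, pow_succ, add_pow_char_pow]
  congr 1
  ring

/-- On the hyperplane `Tr = 0` the form `Q` polarizes to `Tr(x y)`. -/
lemma Q_add (hF : Nat.card F = 2 ^ m) {c₀ : F} (hc : Even m → c₀ + c₀ ^ 2 ^ (m / 2) = 1)
    {x : F} (hx : Tr x = 0) (y : F) :
    Q 2 m c₀ (x + y) = Q 2 m c₀ x + Q 2 m c₀ y + Tr (x * y) := by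
  have hsum : ∑ i ∈ range (m + 1), Tr (x ^ 2 ^ i * y) = Tr (x * y) := by
    rw [sum_range_succ, sum_trace_pow_mul hF hx, pow_two_pow_eq_self hF, zero_add]
  rcases Nat.even_or_odd m with hm | hm
  · obtain ⟨k, hk⟩ := hm
    have hk2 : m / 2 = k := by omega
    have hc' := hc ⟨k, hk⟩
    rw [hk2] at hc'
    have hmid : Tr (c₀ * (x + y) ^ (2 ^ k + 1)) = Tr (c₀ * x ^ (2 ^ k + 1)) +
        Tr (c₀ * y ^ (2 ^ k + 1)) + Tr (x ^ 2 ^ k * y) := by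
      -- apply the `2^k`-power map to one of the two mixed terms
      have h1 : Tr (c₀ * x * y ^ 2 ^ k) = Tr (c₀ ^ 2 ^ k * x ^ 2 ^ k * y) := by
        rw [← trace_pow_two_pow _ k, mul_pow, mul_pow, ← pow_mul, ← pow_add, ← hk,
          pow_two_pow_eq_self hF]
      have h2 : x ^ 2 ^ k * y = c₀ * x ^ 2 ^ k * y + c₀ ^ 2 ^ k * x ^ 2 ^ k * y := by
        linear_combination (-(x ^ 2 ^ k * y)) * hc'
      rw [h2, map_add, ← h1, ← map_add, ← map_add, ← map_add, pow_succ, add_pow_char_pow]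
      congr 1
      ring
    have hrefl : ∑ i ∈ range k, Tr (x ^ 2 ^ (m - i) * y) =
        ∑ i ∈ range k, Tr (x ^ 2 ^ (k + 1 + i) * y) := by
      rw [← sum_range_reflect]
      refine sum_congr rfl fun i hi => ?_
      rw [mem_range] at hi
      congr 4
      omega
    have hsplit := sum_range_add (fun i => Tr (x ^ 2 ^ i * y)) (k + 1) k
    rw [show k + 1 + k = m + 1 by omega, hsum, sum_range_succ] at hsplit
    rw [Q, Q, Q, if_neg (by simpa using ⟨k, hk⟩), if_neg (by simpa using ⟨k, hk⟩),
      if_neg (by simpa using ⟨k, hk⟩), hk2, hmid,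
      sum_congr rfl fun i hi => trace_add_pow hF x y (i := i) (by rw [mem_range] at hi; omega),
      sum_add_distrib, sum_add_distrib, sum_add_distrib, hrefl, hsplit]
    ring
  · obtain ⟨k, hk⟩ := id hm
    have hk2 : (m - 1) / 2 = k := by omega
    have hrefl : ∑ i ∈ range (k + 1), Tr (x ^ 2 ^ (m - i) * y) =
        ∑ i ∈ range (k + 1), Tr (x ^ 2 ^ (k + 1 + i) * y) := by
      rw [← sum_range_reflect]
      refine sum_congr rfl fun i hi => ?_
      rw [mem_range] at hi
      congr 4
      omega
    have hsplit := sum_range_add (fun i => Tr (x ^ 2 ^ i * y)) (k + 1) (k + 1)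
    rw [show k + 1 + (k + 1) = m + 1 by omega, hsum] at hsplit
    rw [Q, Q, Q, if_pos hm, if_pos hm, if_pos hm, hk2,
      sum_congr rfl fun i hi => trace_add_pow hF x y (i := i) (by rw [mem_range] at hi; omega),
      sum_add_distrib, sum_add_distrib, sum_add_distrib, hrefl, hsplit]

omit [Finite F] [CharP F 2] in
lemma Q_zero (c₀ : F) : Q 2 m c₀ 0 = 0 := by
  simp [Q]

/-! ### The characters `α^{(v,w,1)}` -/

lemma neg_one_pow_val_add (s t : ZMod 2) :
    (-1 : ℂ) ^ (s + t).val = (-1) ^ s.val * (-1) ^ t.val := by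
  rw [← pow_add, ZMod.val_add, neg_one_pow_eq_pow_mod_two (n := s.val + t.val)]

/-- The carry of the addition in `F_2`. -/
lemma I_pow_val_mul (s t : ZMod 2) :
    Complex.I ^ s.val * Complex.I ^ t.val = Complex.I ^ (s + t).val * (-1) ^ (s * t).val := by
  have hcases : ∀ s : ZMod 2, s = 0 ∨ s = 1 := by decide
  have h1 : (1 : ZMod 2).val = 1 := rfl
  have h2 : (1 + 1 : ZMod 2) = 0 := rfl
  rcases hcases s with rfl | rfl <;> rcases hcases t with rfl | rfl <;> simp [h1, h2]

omit [Finite F] [CharP F 2] in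
lemma psi_two (v x : F) : psi 2 v x = (-1) ^ (Tr (v * x)).val := by
  rw [psi_apply]
  congr 1
  rw [← Complex.exp_pi_mul_I]
  congr 1
  push_cast
  ring

omit [Finite F] [CharP F 2] in
/-- The sign factors of `α^{(v,w,1)}`, collected into a single exponent in `F_2`. -/
lemma alphaTwo_eq (b₀ c₀ v w b c : F) :
    alphaTwo 2 m b₀ c₀ v w b c =
      Complex.I ^ (Tr (v ^ 2 ^ (m - 1) * b)).val *
        (-1) ^ (Q 2 m c₀ (trPart 2 b₀ (v ^ 2 ^ (m - 1) * b)) +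
          Tr (v ^ 2 ^ (m - 1) * b) * Tr (b₀ * trPart 2 b₀ (v ^ 2 ^ (m - 1) * b)) +
          Tr (w * trPart 2 b₀ (v ^ 2 ^ (m - 1) * b)) + Tr (v * c)).val := by
  simp only [alphaTwo, psi_two, tPart, mul_assoc, trace_algebraMap_mul, neg_one_pow_val_add]

omit [Finite F] [CharP F 2] in
lemma trace_trPart {b₀ : F} (hb : Tr b₀ = 1) (x : F) : Tr (trPart 2 b₀ x) = 0 := by
  rw [trPart, map_sub, trace_algebraMap_mul, hb, mul_one, tPart, sub_self]

omit [Finite F] [CharP F 2] in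
lemma trPart_add (b₀ x y : F) : trPart 2 b₀ (x + y) = trPart 2 b₀ x + trPart 2 b₀ y := by
  simp only [trPart, tPart, map_add]
  ring

omit [CharP F 2] [Algebra (ZMod 2) F] in
lemma sq_pow_pred (hF : Nat.card F = 2 ^ m) (v : F) : (v ^ 2 ^ (m - 1)) ^ 2 = v := by
  have hm : m - 1 + 1 = m := by
    have : m ≠ 0 := by
      rintro rfl
      exact Finite.one_lt_card.ne' hF
    omega
  rw [← pow_mul, ← pow_succ, hm, pow_two_pow_eq_self hF]

/-- `α^{(v,w,1)}` is multiplicative on the centre: with `x = v^{2^{m-1}} b` and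
`y = v^{2^{m-1}} e`, the term `ψ_v(be) = (-1)^{Tr(xy)}` cancels the carry of `i^{κ(t)}` and the
polarization of `Q`. -/
lemma alphaTwo_mul (hF : Nat.card F = 2 ^ m) {b₀ c₀ : F} (hb : Tr b₀ = 1)
    (hc : Even m → c₀ + c₀ ^ 2 ^ (m / 2) = 1) (v w b c e d : F) :
    alphaTwo 2 m b₀ c₀ v w (b + e) (c + d + b * e) =
      alphaTwo 2 m b₀ c₀ v w b c * alphaTwo 2 m b₀ c₀ v w e d := by
  have hsq : v * (b * e) = (v ^ 2 ^ (m - 1) * b) * (v ^ 2 ^ (m - 1) * e) := by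
    linear_combination (-(b * e)) * sq_pow_pred hF v
  rw [alphaTwo_eq, alphaTwo_eq, alphaTwo_eq, mul_add, mul_add, hsq, mul_add, map_add, map_add,
    map_add, mul_mul_mul_comm (Complex.I ^ _), I_pow_val_mul, mul_assoc (Complex.I ^ _), ← neg_one_pow_val_add,
    ← neg_one_pow_val_add]
  generalize v ^ 2 ^ (m - 1) * b = x
  generalize v ^ 2 ^ (m - 1) * e = y
  congr 3
  have hx : x = algebraMap (ZMod 2) F (Tr x) * b₀ + trPart 2 b₀ x := by simp [trPart, tPart]
  have hy : y = algebraMap (ZMod 2) F (Tr y) * b₀ + trPart 2 b₀ y := by simp [trPart, tPart]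
  have hxy : Tr (x * y) = Tr x * Tr y + Tr x * Tr (b₀ * trPart 2 b₀ y) +
      Tr y * Tr (b₀ * trPart 2 b₀ x) + Tr (trPart 2 b₀ x * trPart 2 b₀ y) := by
    have : x * y = algebraMap (ZMod 2) F (Tr x) * (algebraMap (ZMod 2) F (Tr y) * b₀ ^ 2) +
        algebraMap (ZMod 2) F (Tr x) * (b₀ * trPart 2 b₀ y) +
        algebraMap (ZMod 2) F (Tr y) * (b₀ * trPart 2 b₀ x) +
        trPart 2 b₀ x * trPart 2 b₀ y := by
      linear_combination y * hx +
        (algebraMap (ZMod 2) F (Tr x) * b₀ + trPart 2 b₀ x) * hy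
    conv_lhs => rw [this]
    simp only [map_add, trace_algebraMap_mul, trace_sq, hb, mul_one]
  have h2 : (2 : ZMod 2) = 0 := rfl
  rw [trPart_add, Q_add hF hc (trace_trPart hb x), hxy]
  simp only [mul_add, map_add]
  linear_combination (Tr (trPart 2 b₀ x * trPart 2 b₀ y) + Tr x * Tr (b₀ * trPart 2 b₀ y) +
    Tr y * Tr (b₀ * trPart 2 b₀ x)) * h2

omit [Finite F] [CharP F 2] in
lemma alphaTwo_zero_left {b₀ c₀ : F} (v w c : F) :
    alphaTwo 2 m b₀ c₀ v w 0 c = psi 2 v c := by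
  rw [alphaTwo_eq, psi_two]
  simp [trPart, tPart, Q_zero]

omit [Finite F] [CharP F 2] in
/-- `α^{(v,w,1)}` takes the value `i`, and not `-i`, where `v^{2^{m-1}} b = b₀`. -/
lemma alphaTwo_base {b₀ c₀ : F} (hb : Tr b₀ = 1) {v b : F} (w : F)
    (h : v ^ 2 ^ (m - 1) * b = b₀) : alphaTwo 2 m b₀ c₀ v w b 0 = Complex.I := by
  rw [alphaTwo_eq, h, hb]
  simp [trPart, tPart, Q_zero, hb, show (1 : ZMod 2).val = 1 from rfl]

end CharTwo

/-! ### Type `C` in characteristic two -/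

section TypeCTwo

variable {F : Type*} [Field F] [Finite F] [CharP F 2] [Algebra (ZMod 2) F]
  {m : ℕ} {θ : RingAut F}

lemma centerKer_inv {G : Type*} [Group G] (α : Subgroup.center G →* ℂˣ) :
    centerKer α⁻¹ = centerKer α :=
  le_antisymm (centerKer_le_iff.2 fun z h => by simpa using h)
    (centerKer_le_iff.2 fun z h => by simpa using h)

omit [Finite F] [CharP F 2] in
lemma psi_two_sq (v x : F) : psi 2 v x ^ 2 = 1 := by
  rw [psi_two, ← pow_mul, mul_comm, pow_mul, neg_one_sq, one_pow]

theorem C.existsUnique_lift_two (hF : Nat.card F = 2 ^ m) (hθ : θ ≠ 1) {b₀ c₀ : F}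
    (hb : Algebra.trace (ZMod 2) F b₀ = 1) (hc : Even m → c₀ + c₀ ^ 2 ^ (m / 2) = 1)
    {χ : C 2 θ (0 : F) → ℂ} (hχ : χ ∈ Irr1 (C 2 θ (0 : F))) :
    ∃! x : (α : ITwo 2 m θ b₀ c₀) × Irr1 (C 2 θ (0 : F) ⧸ centerKer α.1),
      lift (centerKer x.1.1) x.2.1 = χ := by
  obtain ⟨lam₀, hlam, hmain⟩ := exists_centralChar_existsUnique hχ
  obtain ⟨v, hv0, hv₀⟩ := C.exists_ne_zero_eq_psi hlam
  have hr := sq_pow_pred hF v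
  set r := v ^ 2 ^ (m - 1)
  have hr0 : r ≠ 0 := by
    rintro h
    exact hv0 (by rw [← hr, h]; simp)
  let g := C.central 2 θ (r⁻¹ * b₀) 0
  -- replacing the central character by its inverse does not change its kernel
  obtain ⟨lam, hker, hv, hg⟩ : ∃ lam : Subgroup.center (C 2 θ (0 : F)) →* ℂˣ,
      centerKer lam = centerKer lam₀ ∧ (∀ c, (lam (C.central 2 θ 0 c) : ℂ) = psi 2 v c) ∧
      (lam g : ℂ) = Complex.I := by
    have hsq : (lam₀ g : ℂ) ^ 2 = Complex.I ^ 2 := by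
      have hgg : g ^ 2 = C.central 2 θ 0 (r⁻¹ * b₀ * (r⁻¹ * b₀)) := by
        rw [sq, C.central_mul, CharTwo.add_self_eq_zero, add_zero, zero_add]
      have hvr : v * (r⁻¹ * b₀ * (r⁻¹ * b₀)) = b₀ ^ 2 := by
        rw [← hr]
        field_simp
      rw [← Units.val_pow_eq_pow_val, ← map_pow, hgg, hv₀, psi_two, hvr, trace_sq, hb,
        Complex.I_sq]
      exact pow_one _
    rcases sq_eq_sq_iff_eq_or_eq_neg.1 hsq with h | h
    · exact ⟨lam₀, rfl, hv₀, h⟩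
    · refine ⟨lam₀⁻¹, centerKer_inv _, fun c => ?_, ?_⟩
      · rw [MonoidHom.inv_apply, Units.val_inv_eq_inv_val, hv₀]
        exact inv_eq_of_mul_eq_one_left (by rw [← sq, psi_two_sq])
      · rw [MonoidHom.inv_apply, Units.val_inv_eq_inv_val, h, inv_neg, Complex.inv_I, neg_neg]
  refine hmain (fun α : ITwo 2 m θ b₀ c₀ => centerKer α.1)
    (fun α => centerKer_le_center α.1) ?_
  simp_rw [← hker]
  have hrb : r * (r⁻¹ * b₀) = b₀ := mul_inv_cancel_left₀ hr0 b₀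
  refine ⟨⟨lam, ?_⟩, le_rfl, ?_⟩
  · -- the quotient by `α^{(v,0,1)}` is a character of the coordinate `r b`, trivial on `b₀`
    obtain ⟨α, hα⟩ := C.exists_center_hom (p := 2) hθ (alphaTwo 2 m b₀ c₀ v 0)
      (by rw [alphaTwo_zero_left, AddChar.map_zero_eq_one]) (alphaTwo_mul hF hb hc v 0)
    have hβ : ∀ c, (lam * α⁻¹) (C.central 2 θ 0 c) = 1 := fun c => by
      rw [MonoidHom.mul_apply, MonoidHom.inv_apply, mul_inv_eq_one]
      refine Units.ext ?_
      rw [hv, hα]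
      exact (alphaTwo_zero_left v 0 c).symm
    obtain ⟨w, hw⟩ := exists_eq_psi 2
      (fun x : F => ((lam * α⁻¹) (C.central 2 θ (r⁻¹ * x) 0) : ℂ))
      (by simp [C.central_zero])
      (fun x y => by
        rw [← Units.val_mul, ← map_mul, C.central_mul]
        have : C.central 2 θ (r⁻¹ * x + r⁻¹ * y) (0 + 0 + r⁻¹ * x * (r⁻¹ * y)) =
            C.central 2 θ (r⁻¹ * (x + y)) 0 * C.central 2 θ 0 (r⁻¹ * x * (r⁻¹ * y)) := by
          rw [C.central_mul]
          congr 1 <;> ring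
        rw [this, map_mul, hβ, mul_one])
    have hwb : Algebra.trace (ZMod 2) F (w * b₀) = 0 := by
      rw [← psi_eq_one_iff, ← hw, MonoidHom.mul_apply, MonoidHom.inv_apply, Units.val_mul,
        Units.val_inv_eq_inv_val, hg, hα, C.coe_central, alphaTwo_base hb 0 hrb,
        mul_inv_cancel₀ Complex.I_ne_zero]
    refine ⟨v, w, hv0, fun z => ?_⟩
    have hz : lam z = (lam * α⁻¹) z * α z := by simp
    have hβz : ((lam * α⁻¹) z : ℂ) = psi 2 w (r * z.1.b) := by
      have : z = C.central 2 θ (r⁻¹ * (r * z.1.b)) 0 * C.central 2 θ 0 z.1.c := by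
        rw [C.central_mul, inv_mul_cancel_left₀ hr0, add_zero, mul_zero, add_zero, zero_add]
        exact C.eq_central hθ z
      conv_lhs => rw [this]
      rw [map_mul, hβ, mul_one]
      exact hw _
    have hpart : Algebra.trace (ZMod 2) F (w * (r * z.1.b)) =
        Algebra.trace (ZMod 2) F (w * trPart 2 b₀ (r * z.1.b)) := by
      rw [trPart, mul_sub, map_sub, mul_left_comm w (algebraMap _ _ _), trace_algebraMap_mul, hwb, mul_zero, sub_zero]
    rw [hz, Units.val_mul, hβz, hα, psi_two, hpart, alphaTwo_eq, alphaTwo_eq, mul_left_comm,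
      ← neg_one_pow_val_add, zero_mul, map_zero]
    congr 3
    ring
  · rintro ⟨α, v', w', hv', hα⟩ hle
    replace hle := centerKer_le_iff.1 hle
    have hα0 : ∀ c, (α (C.central 2 θ 0 c) : ℂ) = psi 2 v' c := fun c => by
      rw [hα]
      exact alphaTwo_zero_left v' w' c
    obtain rfl : v' = v := by
      obtain ⟨k, hk⟩ := exists_smul_eq_of_psi_ker_le (p := 2) (v := v') (u := v) fun x hx => by
        rw [← hv, Units.val_eq_one]
        exact hle _ (Units.ext ((hα0 x).trans hx))
      rcases (by decide : ∀ k : ZMod 2, k = 0 ∨ k = 1) k with rfl | rfl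
      · exact absurd (by simpa using hk) hv0
      · simpa using hk.symm
    have hαg : (α g : ℂ) = Complex.I := by
      rw [hα]
      exact alphaTwo_base hb w' hrb
    -- `α` has values in the group generated by `i = α g = lam g`
    refine Subtype.ext (MonoidHom.ext fun z => ?_)
    have h4 : (α z : ℂ) ^ 4 = 1 := by
      have hzz : z ^ 2 = C.central 2 θ 0 (z.1.c + z.1.c + z.1.b * z.1.b) := by
        conv_lhs => rw [C.eq_central hθ z]
        rw [sq, C.central_mul, CharTwo.add_self_eq_zero z.1.b]
      rw [show 4 = 2 * 2 from rfl, pow_mul, ← Units.val_pow_eq_pow_val, ← map_pow, hzz, hα0,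
        psi_two_sq]
    obtain ⟨n, -, hn⟩ := Complex.isPrimitiveRoot_I.eq_pow_of_pow_eq_one h4
    have hαz : α z = α g ^ n := Units.ext (by rw [Units.val_pow_eq_pow_val, hαg, hn])
    have hlz : lam (z * (g ^ n)⁻¹) = 1 := hle _ (by
      rw [map_mul, map_inv, map_pow, hαz, mul_inv_cancel])
    rw [map_mul, map_inv, map_pow, mul_inv_eq_one] at hlz
    rw [hlz, hαz]
    exact congrArg (· ^ n) (Units.ext (hαg.trans hg.symm))

end TypeCTwo

end SuzukiP

theorem lemma4p7 {p m : ℕ} [Fact p.Prime] {F : Type*} [Field F] [Finite F] [CharP F p]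
    [Algebra (ZMod p) F] (hF : Nat.card F = p ^ m) (θ : RingAut F) (hk : 2 < orderOf θ) :
    -- types `A`, `B`, `D`
    (∀ T : Set Fˣ, Subgroup.IsComplement T (SuzukiP.primeUnits F p : Set Fˣ) →
      (∀ χ ∈ SuzukiP.Irr1 (SuzukiP.A θ),
        ∃! x : (v : T) × SuzukiP.Irr1 (SuzukiP.A θ ⧸ SuzukiP.A.H p θ (v.1 : F)),
          SuzukiP.lift (SuzukiP.A.H p θ (x.1.1 : F)) x.2.1 = χ) ∧
      (∀ χ ∈ SuzukiP.Irr1 (SuzukiP.B θ (0 : F)),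
        ∃! x : (v : T) × SuzukiP.Irr1 (SuzukiP.B θ (0 : F) ⧸ SuzukiP.B.H p θ 0 (v.1 : F)),
          SuzukiP.lift (SuzukiP.B.H p θ 0 (x.1.1 : F)) x.2.1 = χ) ∧
      (∀ χ ∈ SuzukiP.Irr1 (SuzukiP.D θ (0 : F)),
        ∃! x : (v : T) × SuzukiP.Irr1 (SuzukiP.D θ (0 : F) ⧸ SuzukiP.D.H p θ 0 (v.1 : F)),
          SuzukiP.lift (SuzukiP.D.H p θ 0 (x.1.1 : F)) x.2.1 = χ)) ∧
    -- type `C`, `p` odd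
    (p ≠ 2 → ∀ σ : Projectivization (ZMod p) (F × F) → F × F,
      (∀ P, ∃ h : σ P ≠ 0, Projectivization.mk (ZMod p) (σ P) h = P) →
      ∀ χ ∈ SuzukiP.Irr1 (SuzukiP.C p θ (0 : F)),
        ∃! x : (α : SuzukiP.IOdd p θ σ) ×
            SuzukiP.Irr1 (SuzukiP.C p θ (0 : F) ⧸ SuzukiP.centerKer α.1),
          SuzukiP.lift (SuzukiP.centerKer x.1.1) x.2.1 = χ) ∧
    -- type `C`, `p = 2`
    (p = 2 → ∀ b₀ c₀ : F, Algebra.trace (ZMod p) F b₀ = 1 →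
      (Even m → c₀ + c₀ ^ 2 ^ (m / 2) = 1) →
      ∀ χ ∈ SuzukiP.Irr1 (SuzukiP.C p θ (0 : F)),
        ∃! x : (α : SuzukiP.ITwo p m θ b₀ c₀) ×
            SuzukiP.Irr1 (SuzukiP.C p θ (0 : F) ⧸ SuzukiP.centerKer α.1),
          SuzukiP.lift (SuzukiP.centerKer x.1.1) x.2.1 = χ) := by
  have hθ : θ ≠ 1 := by
    rintro rfl
    simp at hk
  refine ⟨fun T hT => ⟨fun χ hχ => SuzukiP.A.existsUnique_lift θ hT hχ,
    fun χ hχ => SuzukiP.B.existsUnique_lift θ hT hχ,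
    fun χ hχ => SuzukiP.D.existsUnique_lift θ hT hχ⟩, ?_, ?_⟩
  · intro hp σ hσ χ hχ
    exact SuzukiP.C.existsUnique_lift_odd hθ hp hσ hχ
  · intro hp b₀ c₀ hb hc χ hχ
    subst hp
    exact SuzukiP.C.existsUnique_lift_two hF hθ hb hc hχ
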